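/- For a prime $n \equiv 1 \pmod 4$, the Paley graph $P_n$ has vertex set $\mathbb{F}_n$, and distinct $x, y \in \mathbb{F}_n$ are adjacent if and only if $x - y$ is a square in $\mathbb{F}_n$. There is an absolute constant $c > 0$ such that for every positive integer $k$ and every prime $n \equiv 1 \pmod 4$ with $n \geq 2^{c k (\log_2 k)^2}$, every graph $H$ on $k$ vertices occurs as an induced monochromatic copy in every $2$-edge-colouring of $P_n$; that is, for every colouring of the edges of $P_n$ with two colours, there is an induced subgraph of $P_n$ which is isomorphic to $H$ and all of whose edges have the same colour. -/

import Mathlib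

/-- The Paley graph over a finite field `F` with `q ≡ 1 (mod 4)` elements: the vertices are the
elements of `F`, and distinct `x`, `y` are adjacent if `x - y` is a square in `F`. -/
def paleyGraph (F : Type*) [Field F] [Finite F] {q : ℕ} (hq : Nat.card F = q) (hq4 : q % 4 = 1) :
    SimpleGraph F where
  Adj x y := x ≠ y ∧ IsSquare (x - y)
  symm := ⟨by
    rintro x y ⟨hne, hsq⟩
    refine ⟨hne.symm, ?_⟩
    have := Fintype.ofFinite F
    have h1 : IsSquare (-1 : F) := by
      rw [FiniteField.isSquare_neg_one_iff, ← Nat.card_eq_fintype_card, hq]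
      omega
    have h2 := h1.mul hsq
    rwa [neg_one_mul, neg_sub] at h2⟩
  loopless := ⟨fun _ h => h.1 rfl⟩

/-- The edge-colouring `C` of `G` contains an induced monochromatic copy of `H`: an induced copy
of `H` in `G` (an injective map of vertices preserving adjacency and non-adjacency) all of whose
edges receive one and the same colour. -/
def HasInducedMonoCopy {V W K : Type*} (H : SimpleGraph V) {G : SimpleGraph W}
    (C : G.EdgeLabeling K) : Prop :=
  ∃ (f : H ↪g G) (a : K), ∀ (u v : V) (h : H.Adj u v), C.get (f u) (f v) (f.map_adj_iff.2 h) = a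

/-! The only property of the Paley graph that is used is that its `±1` adjacency kernel has operator
norm at most `√n` (`bilinBound_paleyGraph`), which follows from the orthogonality of translates of
the quadratic character.

Suppose there is no monochromatic induced copy of `H`, and let `R` be the relation of being joined
in colour 0. Embed `H` greedily, with `R` for edges and non-adjacency for non-edges. In every large
set this must get stuck, which yields two large subsets between which `R` or the non-edges are
sparse. Pseudo-randomness rules out the latter, so `R` is sparse (`exists_sparse_pair`). Iterating
inside both halves (`exists_sparse_subset`) gives a set `T`, still large, in which `R` has density
at most a constant times `k ^ (-15)`.

Inside `T` a second greedy embedding uses edges of the graph outside `R`, hence of colour 1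
(`exists_pattern_avoiding`). Here candidate sets only halve at each step, and averaging with the
bilinear bound picks vertices for which the density of `R` hardly grows. This produces a copy in
colour 1, a contradiction. The first stage costs about `log k` rounds, each losing a factor `2 ^ O(k
log k)`; this is the source of the exponent `k (log k) ^ 2`. -/

open Finset

/-! ### Signed adjacency kernels and the bilinear bound -/

/-- The `±1` adjacency kernel of a graph, with zeros on the diagonal. -/
noncomputable def SimpleGraph.sgn {V : Type*} (G : SimpleGraph V) (x y : V) : ℝ :=
  open Classical in if x = y then 0 else if G.Adj x y then 1 else -1

/-- The kernel `χ` has operator norm at most `√n`. -/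
def BilinBound {V : Type*} [Fintype V] (χ : V → V → ℝ) (n : ℝ) : Prop :=
  ∀ f g : V → ℝ, (∑ x, ∑ y, f x * g y * χ x y) ^ 2 ≤ n * (∑ x, f x ^ 2) * (∑ y, g y ^ 2)

theorem SimpleGraph.sgn_of_adj {V : Type*} {G : SimpleGraph V} {x y : V} (h : G.Adj x y) :
    G.sgn x y = 1 := by
  simp [SimpleGraph.sgn, h.ne, h]

theorem SimpleGraph.sgn_of_not_adj {V : Type*} {G : SimpleGraph V} {x y : V} (hne : x ≠ y)
    (h : ¬ G.Adj x y) : G.sgn x y = -1 := by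
  simp [SimpleGraph.sgn, hne, h]

theorem SimpleGraph.abs_sgn_le {V : Type*} (G : SimpleGraph V) (x y : V) : |G.sgn x y| ≤ 1 := by
  unfold SimpleGraph.sgn
  split_ifs <;> simp

/-! ### Character sums and pseudo-randomness of the Paley graph -/

/-- Orthogonality of the translates of the quadratic character. -/
theorem sum_quadraticChar_sub_mul_sub {F : Type*} [Field F] [Fintype F] [DecidableEq F]
    (hF : ringChar F ≠ 2) (y z : F) :
    ∑ a, quadraticChar F (a - y) * quadraticChar F (a - z) =
      if y = z then (Fintype.card F : ℤ) - 1 else -1 := by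
  split_ifs with h
  · subst h
    have h1 : ∀ a : F, quadraticChar F (a - y) * quadraticChar F (a - y) =
        1 - if a = y then 1 else 0 := by
      intro a
      split_ifs with ha
      · simp [ha]
      · rw [← pow_two, quadraticChar_sq_one (sub_ne_zero.2 ha)]; simp
    rw [sum_congr rfl (fun a _ => h1 a)]
    simp
  · have hc : z - y ≠ 0 := sub_ne_zero.2 (Ne.symm h)
    have hJ := jacobiSum_nontrivial_inv (quadraticChar_ne_one hF)
    rw [(quadraticChar_isQuadratic F).inv] at hJ
    -- The affine substitution `a = y + (z - y) x` turns the sum into `χ(-1) J(χ, χ)`, and `J(χ, χ)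
    -- = J(χ, χ⁻¹) = -χ(-1)` since `χ` is quadratic.
    have e : ∑ a, quadraticChar F (a - y) * quadraticChar F (a - z) =
        ∑ x, quadraticChar F (y + (z - y) * x - y) * quadraticChar F (y + (z - y) * x - z) := by
      symm
      exact Fintype.sum_equiv ((Equiv.mulLeft₀ _ hc).trans (Equiv.addLeft y)) _ _ (fun x => rfl)
    have e2 : ∀ x, quadraticChar F (y + (z - y) * x - y) * quadraticChar F (y + (z - y) * x - z)
        = quadraticChar F (-1) * (quadraticChar F x * quadraticChar F (1 - x)) := by
      intro x
      have h3 : y + (z - y) * x - y = (z - y) * x := by ring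
      have h4 : y + (z - y) * x - z = (z - y) * ((-1) * (1 - x)) := by ring
      rw [h3, h4, map_mul, map_mul, map_mul]
      have := quadraticChar_sq_one hc
      linear_combination (quadraticChar F x * quadraticChar F (-1) * quadraticChar F (1 - x)) * this
    rw [e, sum_congr rfl (fun x _ => e2 x), ← mul_sum]
    unfold jacobiSum at hJ
    rw [hJ, mul_neg, ← pow_two, quadraticChar_sq_one (by simp)]

/-- By orthogonality the Gram matrix of the translates is `qI - J` with `J` the all-ones matrix; `J`
is positive semidefinite and can be dropped. -/
theorem sum_quadraticChar_sq_le {F : Type*} [Field F] [Fintype F] [DecidableEq F]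
    (hF : ringChar F ≠ 2) (g : F → ℝ) :
    ∑ x, (∑ y, g y * (quadraticChar F (x - y) : ℝ)) ^ 2 ≤ Fintype.card F * ∑ y, g y ^ 2 := by
  have h1 : ∀ x, (∑ y, g y * (quadraticChar F (x - y) : ℝ)) ^ 2 =
      ∑ y, ∑ z, g y * g z * ((quadraticChar F (x - y) * quadraticChar F (x - z) : ℤ) : ℝ) := by
    intro x
    rw [pow_two, sum_mul_sum]
    refine sum_congr rfl fun y _ => sum_congr rfl fun z _ => ?_
    push_cast; ring
  have h2 : ∀ y z, ∑ x, g y * g z * ((quadraticChar F (x - y) * quadraticChar F (x - z) : ℤ) : ℝ)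
      = (if y = z then (Fintype.card F : ℝ) * g y ^ 2 else 0) - g y * g z := by
    intro y z
    rw [← mul_sum, ← Int.cast_sum, sum_quadraticChar_sub_mul_sub hF]
    split_ifs with h
    · subst h; push_cast; ring
    · push_cast; ring
  rw [sum_congr rfl (fun x _ => h1 x), sum_comm]
  rw [sum_congr rfl (fun y _ => (sum_comm.trans (sum_congr rfl fun z _ => h2 y z)))]
  simp only [sum_sub_distrib, sum_ite_eq, mem_univ, if_true]
  rw [← sum_mul_sum, ← mul_sum]
  nlinarith [mul_self_nonneg (∑ y, g y)]

theorem paleyGraph_sgn {F : Type*} [Field F] [Fintype F] [DecidableEq F] {q : ℕ}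
    (hq : Nat.card F = q) (hq4 : q % 4 = 1) (x y : F) :
    (paleyGraph F hq hq4).sgn x y = (quadraticChar F (x - y) : ℝ) := by
  by_cases h : x = y
  · subst h; simp [SimpleGraph.sgn]
  have h0 : x - y ≠ 0 := sub_ne_zero.2 h
  by_cases hs : IsSquare (x - y)
  · rw [SimpleGraph.sgn_of_adj (show (paleyGraph F hq hq4).Adj x y from ⟨h, hs⟩), (quadraticChar_one_iff_isSquare h0).2 hs]; simp
  · rw [SimpleGraph.sgn_of_not_adj h (fun h' : (paleyGraph F hq hq4).Adj x y => hs h'.2),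
      quadraticChar_neg_one_iff_not_isSquare.2 hs]; simp

theorem bilinBound_paleyGraph {F : Type*} [Field F] [Fintype F] {q : ℕ}
    (hq : Nat.card F = q) (hq4 : q % 4 = 1) : BilinBound (paleyGraph F hq hq4).sgn q := by
  classical
  intro f g
  have hF : ringChar F ≠ 2 := by
    intro h
    have := FiniteField.even_card_iff_char_two.1 h
    rw [← Nat.card_eq_fintype_card, hq] at this
    omega
  simp only [paleyGraph_sgn, mul_assoc, ← mul_sum]
  refine (sum_mul_sq_le_sq_mul_sq _ _ _).trans ?_
  have := sum_quadraticChar_sq_le hF g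
  rw [← Nat.card_eq_fintype_card, hq] at this
  calc _ ≤ (∑ x, f x ^ 2) * (q * ∑ y, g y ^ 2) := by gcongr
    _ = _ := by ring

theorem BilinBound.sq_sum_le {V : Type*} [Fintype V] {χ : V → V → ℝ} {n : ℝ}
    (hχ : BilinBound χ n) (hn : 0 ≤ n) (A B : Finset V) (f g : V → ℝ) (hf : ∀ x, |f x| ≤ 1)
    (hg : ∀ x, |g x| ≤ 1) :
    (∑ x ∈ A, ∑ y ∈ B, f x * g y * χ x y) ^ 2 ≤ n * #A * #B := by
  classical
  have h := hχ (fun x => if x ∈ A then f x else 0) (fun x => if x ∈ B then g x else 0)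
  have h1 : ∀ (A : Finset V) (f : V → ℝ), (∀ x, |f x| ≤ 1) →
      ∑ x, (if x ∈ A then f x else 0) ^ 2 ≤ #A := by
    intro A f hf
    calc ∑ x, (if x ∈ A then f x else 0) ^ 2 ≤ ∑ x, (if x ∈ A then 1 else 0) := by
          refine sum_le_sum fun x _ => ?_
          split_ifs
          · exact (sq_le_one_iff_abs_le_one _).2 (hf x)
          · simp
      _ = _ := by simp
  have h2 : (∑ x, ∑ y, (if x ∈ A then f x else 0) * (if y ∈ B then g y else 0) * χ x y) =
      ∑ x ∈ A, ∑ y ∈ B, f x * g y * χ x y := by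
    simp [ite_mul, Finset.sum_ite_mem]
  rw [h2] at h
  refine h.trans ?_
  gcongr
  · exact h1 A f hf
  · exact h1 B g hg

/-! ### Greedy embedding and iteration of sparse pairs -/

/-- Greedy embedding: an invariant of families of candidate sets which survives the choice of
the first vertex produces a copy of every pattern. -/
theorem exists_pattern_of_step {V : Type*} (rel : Bool → V → V → Prop)
    (P : ∀ m, (Fin m → Finset V) → Prop)
    (step : ∀ m A (s : Fin m → Bool), P (m + 1) A →
      ∃ v ∈ A 0, ∃ B : Fin m → Finset V,
        P m B ∧ (∀ j, B j ⊆ A j.succ) ∧ ∀ j, ∀ y ∈ B j, rel (s j) v y) :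
    ∀ m (s : Fin m → Fin m → Bool) A, P m A →
      ∃ f : Fin m → V, (∀ j, f j ∈ A j) ∧ ∀ i j, i < j → rel (s i j) (f i) (f j) := by
  intro m
  induction m with
  | zero => exact fun s A _ => ⟨Fin.elim0, fun j => j.elim0, fun i => i.elim0⟩
  | succ m ih =>
    intro s A hA
    obtain ⟨v, hv, B, hPB, hBA, hB⟩ := step m A (fun j => s 0 j.succ) hA
    obtain ⟨f, hfB, hf⟩ := ih (fun i j => s i.succ j.succ) B hPB
    refine ⟨Fin.cons v f, fun j => ?_, fun i j => ?_⟩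
    · refine Fin.cases ?_ (fun j => ?_) j
      · simpa using hv
      · simpa using hBA j (hfB j)
    · refine Fin.cases ?_ (fun i => ?_) i <;> refine Fin.cases ?_ (fun j => ?_) j
      · simp
      · intro _; simpa using hB j _ (hfB j)
      · simp
      · intro hij; simpa using hf i j (by simpa using hij)

theorem exists_disjoint_subsets {V : Type*} [DecidableEq V] (N k : ℕ) (S : Finset V)
    (h : k * N ≤ #S) :
    ∃ A : Fin k → Finset V, (∀ i, A i ⊆ S) ∧ (∀ i, #(A i) = N) ∧
      ∀ i j, i ≠ j → Disjoint (A i) (A j) := by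
  induction k generalizing S with
  | zero => exact ⟨Fin.elim0, fun i => i.elim0, fun i => i.elim0, fun i => i.elim0⟩
  | succ k ih =>
    obtain ⟨T, hT, hTc⟩ := exists_subset_card_eq (s := S) (n := N) (by nlinarith)
    obtain ⟨A, hA, hAc, hAd⟩ := ih (S \ T) (by rw [card_sdiff_of_subset hT, hTc]
                                               rw [add_mul] at h; omega)
    have hd : ∀ i, Disjoint T (A i) := fun i =>
      (disjoint_sdiff_self_right.mono_right (hA i))
    refine ⟨Fin.cons T A, fun i => ?_, fun i => ?_, fun i j => ?_⟩
    · refine Fin.cases ?_ (fun i => ?_) i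
      · simpa using hT
      · simpa using (hA i).trans sdiff_subset
    · refine Fin.cases ?_ (fun i => ?_) i
      · simpa using hTc
      · simpa using hAc i
    · refine Fin.cases ?_ (fun i => ?_) i <;> refine Fin.cases ?_ (fun j => ?_) j
      · simp
      · intro _; simpa using hd j
      · intro _; simpa using (hd i).symm
      · intro hij; simpa using hAd i j (by simpa using hij)

open Classical in
/-- Repeated passage to sparse pairs produces a large set spanning few pairs of `R`. -/
theorem exists_sparse_subset {V : Type*} (R : V → V → Prop) (hR : ∀ x y, R x y → R y x)
    (h D m : ℕ) (hD : 0 < D)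
    (pair : ∀ S : Finset V, 2 * D * m ≤ #S → ∃ A B, A ⊆ S ∧ B ⊆ S ∧ Disjoint A B ∧
      #S ≤ D * #A ∧ #S ≤ D * #B ∧ ∀ a ∈ A, 2 ^ h * #{b ∈ B | R a b} ≤ #B) :
    ∀ (i : ℕ) (S : Finset V), (2 * D) ^ i * m ≤ #S → ∃ T ⊆ S, #T = 2 ^ i * m ∧
      2 ^ h * (∑ x ∈ T, #{y ∈ T | R x y}) ≤ (2 ^ h * 2 ^ i + 2 * 4 ^ i) * m ^ 2 := by
  intro i
  induction i with
  | zero =>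
    intro S hS
    obtain ⟨T, hT, hTc⟩ := exists_subset_card_eq (s := S) (n := m) (by simpa using hS)
    refine ⟨T, hT, by simpa using hTc, ?_⟩
    have : ∑ x ∈ T, #{y ∈ T | R x y} ≤ ∑ x ∈ T, m :=
      sum_le_sum fun x _ => (card_filter_le _ _).trans hTc.le
    rw [sum_const, hTc, smul_eq_mul] at this
    calc _ ≤ 2 ^ h * (m * m) := by gcongr
      _ ≤ _ := by nlinarith
  | succ i ih =>
    intro S hS
    have hp : 0 < (2 * D) ^ i := by positivity
    obtain ⟨A, B, hAS, hBS, hAB, hA, hB, hd⟩ := pair S (by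
      refine le_trans ?_ hS
      rw [pow_succ, mul_assoc]
      nlinarith [Nat.zero_le (2 * D * m)])
    have hS' : 2 * D * ((2 * D) ^ i * m) ≤ #S := by rw [pow_succ] at hS; linarith
    obtain ⟨A', hA', hA'c, hA'e⟩ := ih A (by
      have := hS'.trans hA
      have : D * (2 * ((2 * D) ^ i * m)) ≤ D * #A := by linarith
      have := Nat.le_of_mul_le_mul_left this hD
      omega)
    -- Sparsity from `A` to `B` need not pass to a subset of `B`. So `A'` is fixed first, and `B` is
    -- cut down to the vertices whose `R`-density into `A'` is at most twice the average bound. By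
    -- Markov at least half of `B` remains (hence `2 * D`), and any `B' ⊆ B₁` is then sparse to
    -- `A'`.
    set B₁ := {b ∈ B | 2 ^ h * #{a ∈ A' | R a b} ≤ 2 * #A'} with hB₁
    have hdc : ∑ a ∈ A', #{b ∈ B | R a b} = ∑ b ∈ B, #{a ∈ A' | R a b} :=
      sum_card_bipartiteAbove_eq_sum_card_bipartiteBelow _
    have hBcard : #B ≤ 2 * #B₁ := by
      have h1 : 2 ^ h * ∑ a ∈ A', #{b ∈ B | R a b} ≤ #A' * #B := by
        rw [mul_sum, ← smul_eq_mul, ← sum_const]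
        exact sum_le_sum fun a ha => hd a (hA' ha)
      have h2 : #{b ∈ B | ¬ 2 ^ h * #{a ∈ A' | R a b} ≤ 2 * #A'} * (2 * #A' + 1) ≤
          2 ^ h * ∑ b ∈ B, #{a ∈ A' | R a b} := by
        rw [mul_sum, ← smul_eq_mul, ← sum_const]
        calc _ ≤ ∑ b ∈ B with ¬ 2 ^ h * #{a ∈ A' | R a b} ≤ 2 * #A',
              2 ^ h * #{a ∈ A' | R a b} := by
              refine sum_le_sum fun b hb => ?_
              have := (mem_filter.1 hb).2
              omega
          _ ≤ _ := sum_le_sum_of_subset (filter_subset _ _)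
      have h3 := card_filter_add_card_filter_not (s := B)
        (fun b => 2 ^ h * #{a ∈ A' | R a b} ≤ 2 * #A')
      rw [← hB₁] at h3
      rw [hdc] at h1
      have h4 := h2.trans h1
      generalize #{b ∈ B | ¬ 2 ^ h * #{a ∈ A' | R a b} ≤ 2 * #A'} = q at h3 h4
      by_contra hlt
      have hpq : #A' * #B ≤ #A' * (2 * q) := Nat.mul_le_mul_left _ (by omega)
      have : q = 0 := by nlinarith
      omega
    obtain ⟨B', hB', hB'c, hB'e⟩ := ih B₁ (by
      have := hS'.trans hB
      have : D * (2 * ((2 * D) ^ i * m)) ≤ D * #B := by linarith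
      have := Nat.le_of_mul_le_mul_left this hD
      omega)
    have hB'B : B' ⊆ B := hB'.trans (filter_subset _ _)
    have hdis : Disjoint A' B' := (hAB.mono_left hA').mono_right hB'B
    refine ⟨A' ∪ B', union_subset (hA'.trans hAS) (hB'B.trans hBS), ?_, ?_⟩
    · rw [card_union_of_disjoint hdis, hA'c, hB'c]; ring
    · have hsplit : ∀ x, #{y ∈ A' ∪ B' | R x y} = #{y ∈ A' | R x y} + #{y ∈ B' | R x y} := by
        intro x
        rw [filter_union, card_union_of_disjoint (disjoint_filter_filter hdis)]
      have hc1 : ∑ a ∈ A', #{b ∈ B' | R a b} = ∑ b ∈ B', #{a ∈ A' | R b a} := by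
        rw [show ∑ a ∈ A', #{b ∈ B' | R a b} = ∑ b ∈ B', #{a ∈ A' | R a b} from
          sum_card_bipartiteAbove_eq_sum_card_bipartiteBelow _]
        refine sum_congr rfl fun b _ => congrArg _ (filter_congr fun a _ => ?_)
        exact ⟨hR _ _, hR _ _⟩
      have hc2 : 2 ^ h * ∑ b ∈ B', #{a ∈ A' | R b a} ≤ #B' * (2 * #A') := by
        rw [mul_sum, ← smul_eq_mul, ← sum_const]
        refine sum_le_sum fun b hb => ?_
        have := (mem_filter.1 (hB' hb)).2
        refine le_trans (le_of_eq ?_) this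
        refine congrArg _ (congrArg _ (filter_congr fun a _ => ?_))
        exact ⟨hR _ _, hR _ _⟩
      rw [sum_union hdis]
      simp only [hsplit, sum_add_distrib]
      rw [hc1]
      rw [hA'c, hB'c] at hc2
      have h4 : (4 : ℕ) ^ i = 2 ^ i * 2 ^ i := by rw [← mul_pow]; norm_num
      rw [h4] at hA'e hB'e
      rw [pow_succ 4, h4, pow_succ 2 i]
      linarith

/-! ### A missing pattern forces a sparse pair -/

open Classical in
theorem SimpleGraph.sum_sgn {V : Type*} (G : SimpleGraph V) (v : V) (B : Finset V) (hv : v ∉ B) :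
    ∑ y ∈ B, G.sgn v y = #B - 2 * (#{y ∈ B | ¬ G.Adj v y} : ℝ) := by
  have h : ∀ y ∈ B, G.sgn v y = 1 - 2 * (if ¬ G.Adj v y then 1 else 0) := by
    intro y hy
    have hne : v ≠ y := fun h => hv (h ▸ hy)
    by_cases ha : G.Adj v y
    · simp [SimpleGraph.sgn_of_adj ha, ha]
    · rw [SimpleGraph.sgn_of_not_adj hne ha, if_pos ha]; norm_num
  rw [sum_congr rfl h, sum_sub_distrib, ← mul_sum, sum_boole]
  simp

open Classical in
theorem card_mul_card_le_of_few_nonadj {V : Type*} [Fintype V] (G : SimpleGraph V) {n : ℝ}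
    (hn : 0 ≤ n) (hG : BilinBound G.sgn n) (A B : Finset V) (hAB : Disjoint A B)
    (h : ∀ a ∈ A, 4 * #{b ∈ B | ¬ G.Adj a b} ≤ #B) : (#A * #B : ℝ) ≤ 4 * n := by
  have h1 := hG.sq_sum_le hn A B (fun _ => 1) (fun _ => 1) (by simp) (by simp)
  simp only [one_mul] at h1
  have h2 : (#A * #B / 2 : ℝ) ≤ ∑ a ∈ A, ∑ b ∈ B, G.sgn a b := by
    calc (#A * #B / 2 : ℝ) = ∑ a ∈ A, (#B / 2 : ℝ) := by simp [mul_div_assoc]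
      _ ≤ _ := by
        refine sum_le_sum fun a ha => ?_
        rw [G.sum_sgn a B (disjoint_left.1 hAB ha)]
        have : (4 * #{b ∈ B | ¬ G.Adj a b} : ℝ) ≤ #B := by exact_mod_cast h a ha
        linarith
  have h3 : (#A * #B / 2 : ℝ) ^ 2 ≤ n * #A * #B := le_trans (by gcongr) h1
  by_contra hlt
  push Not at hlt
  have h4 : 0 < (#A * #B : ℝ) := by linarith
  nlinarith

open Classical in
/-- If no injective map realises the pattern `s` by pairs of `R` and non-edges of a
pseudo-random graph, every large set contains a pair of large sets which is sparse for `R`. -/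
theorem exists_sparse_pair {V : Type*} [Fintype V] (G : SimpleGraph V) {n : ℝ}
    (hn : 0 ≤ n) (hG : BilinBound G.sgn n) (R : V → V → Prop) (k h : ℕ) (hk : 0 < k) (hh : 2 ≤ h)
    (s : Fin k → Fin k → Bool)
    (hno : ∀ f : Fin k → V, Function.Injective f → ¬ ∀ i j, i < j →
      if s i j then R (f i) (f j) else ¬ G.Adj (f i) (f j))
    (S : Finset V) (hS : k ≤ #S) (hSn : 4 * n * (2 * k ^ 2 * 2 ^ (h * k)) ^ 2 < (#S : ℝ) ^ 2) :
    ∃ A B, A ⊆ S ∧ B ⊆ S ∧ Disjoint A B ∧ #S ≤ 2 * k ^ 2 * 2 ^ (h * k) * #A ∧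
      #S ≤ 2 * k ^ 2 * 2 ^ (h * k) * #B ∧ ∀ a ∈ A, 2 ^ h * #{b ∈ B | R a b} ≤ #B := by
  by_contra hcon
  set N := #S / k with hN
  have hN0 : 0 < N := Nat.div_pos hS hk
  have hSN : #S ≤ 2 * k * N := by
    have h1 := Nat.lt_mul_div_succ #S hk
    rw [← hN] at h1
    nlinarith
  obtain ⟨A₀, hA₀S, hA₀c, hA₀d⟩ := exists_disjoint_subsets N k S (Nat.mul_div_le _ _)
  -- With `m` vertices still to place, each candidate set has lost at most a factor `2 ^ h` for each
  -- of the `k - m` vertices placed.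
  have key := exists_pattern_of_step (fun b v y => if b then R v y else ¬ G.Adj v y)
    (fun m A => m ≤ k ∧ (∀ i, A i ⊆ S) ∧ (∀ i j, i ≠ j → Disjoint (A i) (A j)) ∧
      ∀ i, 2 ^ (h * m) * N ≤ 2 ^ (h * k) * #(A i)) ?_ k s A₀
      ⟨le_rfl, hA₀S, hA₀d, fun i => by rw [hA₀c]⟩
  · obtain ⟨f, hfA, hf⟩ := key
    refine hno f (fun i j hij => ?_) hf
    by_contra hne
    exact disjoint_left.1 (hA₀d i j hne) (hfA i) (hij ▸ hfA j)
  · rintro m A s ⟨hmk, hAS, hAd, hAc⟩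
    set rel : Bool → V → V → Prop := fun b v y => if b then R v y else ¬ G.Adj v y
    have hbig : ∀ i, #S ≤ 2 * k ^ 2 * 2 ^ (h * k) * #(A i) ∧ 0 < #(A i) := by
      intro i
      have h1 : N ≤ 2 ^ (h * k) * #(A i) :=
        le_trans (Nat.le_mul_of_pos_left _ (by positivity)) (hAc i)
      have h2 : 0 < #(A i) := by
        by_contra h0
        have : #(A i) = 0 := by omega
        rw [this] at h1
        omega
      refine ⟨?_, h2⟩
      calc #S ≤ 2 * k * (2 ^ (h * k) * #(A i)) := hSN.trans (by gcongr)
        _ ≤ 2 * k ^ 2 * (2 ^ (h * k) * #(A i)) := by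
          gcongr
          exact Nat.le_self_pow (by norm_num) k
        _ = _ := by ring
    -- If a bad set exceeded a `1 / k` share of `A 0`, it would form with `A j.succ` a sparse pair
    -- for `R` (excluded by `hcon`) or for non-edges (excluded by the bilinear bound). As `m < k`,
    -- the bad sets then fail to cover `A 0`.
    set Bad : Fin m → Finset V := fun j =>
      {v ∈ A 0 | 2 ^ h * #{y ∈ A j.succ | rel (s j) v y} ≤ #(A j.succ)} with hBad
    have hbad : ∀ j, k * #(Bad j) ≤ #(A 0) := by
      intro j
      by_contra hlt
      push Not at hlt
      have hB1 : #S ≤ 2 * k ^ 2 * 2 ^ (h * k) * #(Bad j) := by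
        have h1 : N ≤ 2 ^ (h * k) * #(A 0) :=
          le_trans (Nat.le_mul_of_pos_left _ (by positivity)) (hAc 0)
        calc #S ≤ 2 * k * (2 ^ (h * k) * (k * #(Bad j))) := by
              refine hSN.trans (Nat.mul_le_mul_left _ (h1.trans (Nat.mul_le_mul_left _ hlt.le)))
          _ = _ := by ring
      have hBS : Bad j ⊆ A 0 := filter_subset _ _
      have hdis : Disjoint (Bad j) (A j.succ) :=
        (hAd 0 j.succ (Fin.succ_ne_zero j).symm).mono_left hBS
      cases hs : s j with
      | true =>
        refine hcon ⟨Bad j, A j.succ, hBS.trans (hAS 0), hAS _, hdis, hB1, (hbig _).1, ?_⟩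
        intro a ha
        have h1 := (mem_filter.1 ha).2
        rw [hs] at h1
        exact h1
      | false =>
        have := card_mul_card_le_of_few_nonadj G hn hG (Bad j) (A j.succ) hdis (by
          intro a ha
          have h1 : 2 ^ h * #{y ∈ A j.succ | ¬ G.Adj a y} ≤ #(A j.succ) := by
            have h1 := (mem_filter.1 ha).2
            rw [hs] at h1
            exact h1
          refine le_trans (Nat.mul_le_mul_right _ ?_) h1
          calc 4 = 2 ^ 2 := by norm_num
            _ ≤ 2 ^ h := Nat.pow_le_pow_right (by norm_num) hh)
        have h1 : (#S : ℝ) ≤ 2 * k ^ 2 * 2 ^ (h * k) * #(Bad j) := by exact_mod_cast hB1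
        have h2 : (#S : ℝ) ≤ 2 * k ^ 2 * 2 ^ (h * k) * #(A j.succ) := by
          exact_mod_cast (hbig j.succ).1
        refine absurd hSn (not_lt.2 ?_)
        calc (#S : ℝ) ^ 2 = #S * #S := by ring
          _ ≤ (2 * k ^ 2 * 2 ^ (h * k) * #(Bad j)) * (2 * k ^ 2 * 2 ^ (h * k) * #(A j.succ)) :=
            mul_le_mul h1 h2 (Nat.cast_nonneg _) ((Nat.cast_nonneg _).trans h1)
          _ = (#(Bad j) * #(A j.succ)) * (2 * k ^ 2 * 2 ^ (h * k)) ^ 2 := by ring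
          _ ≤ _ := mul_le_mul_of_nonneg_right this (sq_nonneg _)
    obtain ⟨v, hv, hvB⟩ : ∃ v ∈ A 0, ∀ j, v ∉ Bad j := by
      by_contra hall
      push Not at hall
      have hsub : A 0 ⊆ univ.biUnion Bad := fun v hv => by
        obtain ⟨j, hj⟩ := hall v hv
        exact mem_biUnion.2 ⟨j, mem_univ _, hj⟩
      have h1 : k * #(A 0) ≤ m * #(A 0) := by
        calc k * #(A 0) ≤ k * ∑ j, #(Bad j) := by
              gcongr
              exact (card_le_card hsub).trans card_biUnion_le
          _ ≤ ∑ _j : Fin m, #(A 0) := by rw [mul_sum]; exact sum_le_sum fun j _ => hbad j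
          _ = _ := by simp
      have := Nat.le_of_mul_le_mul_right h1 (hbig 0).2
      omega
    refine ⟨v, hv, fun j => {y ∈ A j.succ | rel (s j) v y}, ⟨by omega, fun i => ?_, fun i j hij => ?_,
      fun i => ?_⟩, fun j => filter_subset _ _, fun j y hy => (mem_filter.1 hy).2⟩
    · exact (filter_subset _ _).trans (hAS _)
    · exact disjoint_filter_filter (hAd _ _ (by simpa using hij))
    · have h1 : ¬ 2 ^ h * #{y ∈ A i.succ | rel (s i) v y} ≤ #(A i.succ) := fun hle =>
        hvB i (mem_filter.2 ⟨hv, hle⟩)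
      have h2 := hAc i.succ
      have h3 : 2 ^ h * (2 ^ (h * m) * N) ≤
          2 ^ h * (2 ^ (h * k) * #{y ∈ A i.succ | rel (s i) v y}) := by
        calc 2 ^ h * (2 ^ (h * m) * N) = 2 ^ (h * (m + 1)) * N := by ring
          _ ≤ 2 ^ (h * k) * #(A i.succ) := h2
          _ ≤ 2 ^ (h * k) * (2 ^ h * #{y ∈ A i.succ | rel (s i) v y}) := by gcongr; omega
          _ = _ := by ring
      exact Nat.le_of_mul_le_mul_left h3 (by positivity)

/-! ### Embedding while avoiding a sparse relation -/

theorem BilinBound.sum_le {V : Type*} [Fintype V] {χ : V → V → ℝ} {σ : ℝ} (hσ : 0 ≤ σ)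
    (hV : (Fintype.card V : ℝ) = σ ^ 2)
    (hχ : BilinBound χ (σ ^ 2)) (A B : Finset V) (f g : V → ℝ) (hf : ∀ x, |f x| ≤ 1)
    (hg : ∀ x, |g x| ≤ 1) :
    ∑ x ∈ A, ∑ y ∈ B, f x * g y * χ x y ≤ σ ^ 3 := by
  have hc : ∀ A : Finset V, (#A : ℝ) ≤ σ ^ 2 := fun A => by
    rw [← hV]; exact_mod_cast card_le_univ A
  refine le_of_abs_le (abs_le_of_sq_le_sq ?_ (by positivity))
  calc _ ≤ σ ^ 2 * #A * #B := hχ.sq_sum_le (by positivity) A B f g hf hg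
    _ ≤ σ ^ 2 * σ ^ 2 * σ ^ 2 := by gcongr <;> exact hc _
    _ = _ := by ring

theorem BilinBound.sum_sum_le {V : Type*} [Fintype V] {χ : V → V → ℝ} {σ : ℝ} (hσ : 0 ≤ σ)
    (hV : (Fintype.card V : ℝ) = σ ^ 2)
    (hχ : BilinBound χ (σ ^ 2)) (Z A B : Finset V) (f g : V → V → ℝ) (hf : ∀ z x, |f z x| ≤ 1)
    (hg : ∀ z x, |g z x| ≤ 1) :
    ∑ z ∈ Z, ∑ x ∈ A, ∑ y ∈ B, f z x * g z y * χ x y ≤ σ ^ 5 := by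
  calc _ ≤ ∑ z ∈ Z, σ ^ 3 :=
        sum_le_sum fun z _ => hχ.sum_le hσ hV A B (f z) (g z) (hf z) (hg z)
    _ = #Z * σ ^ 3 := by simp
    _ ≤ σ ^ 2 * σ ^ 3 := by
        gcongr
        rw [← hV]; exact_mod_cast card_le_univ Z
    _ = _ := by ring

/-- On average over `v ∈ A`, a quarter of the weight of `r` on `X × Y` survives in the product of
prescribed (non-)neighbourhoods of `v`. -/
theorem BilinBound.sum_weight_le {V : Type*} [Fintype V] {χ : V → V → ℝ} {σ : ℝ} (hσ : 0 ≤ σ)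
    (hV : (Fintype.card V : ℝ) = σ ^ 2)
    (hχ : BilinBound χ (σ ^ 2)) (hχ1 : ∀ x y, |χ x y| ≤ 1) (A X Y : Finset V) (r : V → V → ℝ)
    (hr : ∀ x y, |r x y| ≤ 1) (e e' : ℝ) (he : |e| ≤ 1) (he' : |e'| ≤ 1) :
    ∑ v ∈ A, ∑ x ∈ X, ∑ y ∈ Y, r x y * ((1 + e * χ v x) / 2) * ((1 + e' * χ v y) / 2) ≤
      #A / 4 * (∑ x ∈ X, ∑ y ∈ Y, r x y) + 3 / 4 * σ ^ 5 := by
  -- Expanding the product leaves three error terms. Freezing `y` in the first and `x` in the other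
  -- two gives bilinear forms with bounded weights; in the third, `χ v x` is absorbed into the
  -- weight of `v`.
  have h1 : ∑ v ∈ A, ∑ x ∈ X, ∑ y ∈ Y, e * r x y * χ v x ≤ σ ^ 5 := by
    refine le_trans (le_of_eq ?_) (hχ.sum_sum_le hσ hV Y A X (fun _ _ => e) (fun y x => r x y)
      (fun _ _ => he) (fun y x => hr x y))
    exact (sum_congr rfl fun v _ => sum_comm).trans sum_comm
  have h2 : ∑ v ∈ A, ∑ x ∈ X, ∑ y ∈ Y, e' * r x y * χ v y ≤ σ ^ 5 := by
    refine le_trans (le_of_eq ?_) (hχ.sum_sum_le hσ hV X A Y (fun _ _ => e') (fun x y => r x y)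
      (fun _ _ => he') (fun y x => hr y x))
    exact sum_comm
  have h3 : ∑ v ∈ A, ∑ x ∈ X, ∑ y ∈ Y, e * e' * χ v x * r x y * χ v y ≤ σ ^ 5 := by
    refine le_trans (le_of_eq ?_) (hχ.sum_sum_le hσ hV X A Y (fun x v => e * e' * χ v x)
      (fun x y => r x y) (fun x v => ?_) (fun y x => hr y x))
    · exact sum_comm
    · rw [abs_mul, abs_mul]
      exact mul_le_one₀ (mul_le_one₀ he (abs_nonneg _) he') (abs_nonneg _) (hχ1 _ _)
  have h4 : #A / 4 * (∑ x ∈ X, ∑ y ∈ Y, r x y) = ∑ v ∈ A, ∑ x ∈ X, ∑ y ∈ Y, r x y / 4 := by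
    simp only [← sum_div, sum_const, nsmul_eq_mul]
    ring
  calc _ = ∑ v ∈ A, ∑ x ∈ X, ∑ y ∈ Y, r x y / 4 +
        1 / 4 * (∑ v ∈ A, ∑ x ∈ X, ∑ y ∈ Y, e * r x y * χ v x) +
        1 / 4 * (∑ v ∈ A, ∑ x ∈ X, ∑ y ∈ Y, e' * r x y * χ v y) +
        1 / 4 * (∑ v ∈ A, ∑ x ∈ X, ∑ y ∈ Y, e * e' * χ v x * r x y * χ v y) := by
        simp only [mul_sum, ← sum_add_distrib]
        refine sum_congr rfl fun v _ => sum_congr rfl fun x _ => sum_congr rfl fun y _ => ?_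
        ring
    _ ≤ _ := by rw [h4]; linarith

open Classical in
/-- Few vertices of `A` have too few neighbours (or non-neighbours) in `B`. -/
theorem card_deficient_mul_le {V : Type*} [Fintype V] (G : SimpleGraph V) {σ : ℝ} (hσ : 0 ≤ σ)
    (hV : (Fintype.card V : ℝ) = σ ^ 2) (hG : BilinBound G.sgn (σ ^ 2)) (b : Bool) (δ : ℝ)
    (A B : Finset V) (hAB : Disjoint A B)
    (h : ∀ a ∈ A, (#{y ∈ B | (G.Adj a y ↔ b = true)} : ℝ) ≤ #B / 2 - δ) : 2 * δ * #A ≤ σ ^ 3 := by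
  -- The sign is chosen so that a deficiency on side `b` contributes positively.
  have h1 := hG.sum_le hσ hV A B (fun _ => if b then -1 else 1) (fun _ => 1)
    (by intro _; split_ifs <;> simp) (by simp)
  refine le_trans ?_ h1
  calc 2 * δ * #A = ∑ a ∈ A, 2 * δ := by simp [mul_comm]
    _ ≤ _ := by
      refine sum_le_sum fun a ha => ?_
      have h2 := h a ha
      have h3 := G.sum_sgn a B (disjoint_left.1 hAB ha)
      have h4 := card_filter_add_card_filter_not (s := B) (fun y => G.Adj a y)
      have h5 : (#{y ∈ B | G.Adj a y} : ℝ) + #{y ∈ B | ¬ G.Adj a y} = #B := by exact_mod_cast h4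
      rw [← mul_sum]
      simp only [mul_one]
      rw [h3]
      cases b
      · simp only [Bool.false_eq_true, iff_false] at h2
        simp only [Bool.false_eq_true, if_false]
        linarith
      · simp only [iff_true] at h2
        simp only [if_true]
        linarith

open Classical in
/-- One step of the embedding avoiding a sparse relation `R`: some `v ∈ A 0` leaves candidate sets
about half as large, with almost no increase of the density of `R`. -/
theorem exists_step_vertex {V : Type*} [Fintype V] (G : SimpleGraph V) {σ : ℝ} (hσ : 0 ≤ σ)
    (hV : (Fintype.card V : ℝ) = σ ^ 2) (hG : BilinBound G.sgn (σ ^ 2)) (R : V → V → Prop)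
    (m : ℕ) (s : Fin m → Bool) (A : Fin (m + 1) → Finset V)
    (hd : ∀ j : Fin m, Disjoint (A 0) (A j.succ)) (κ μ φ θ : ℝ) (hκ : 0 < κ) (hm : m * κ ≤ 1)
    (hμ : 0 < μ) (hφ : 0 < φ) (hθ : 0 ≤ θ) (hθ1 : θ + κ ≤ 1)
    (hA : ∀ j, μ * (1 - θ / 2) ≤ #(A j))
    (hΦ : ∑ i, ∑ j, ∑ x ∈ A i, ∑ y ∈ A j, (if R x y then (1 : ℝ) else 0) ≤ μ ^ 2 * φ * (1 + θ))
    (h1 : 128 * σ ^ 3 ≤ μ ^ 2 * κ ^ 3) (h2 : 24 * σ ^ 5 ≤ μ ^ 3 * φ * κ ^ 3)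
    (h3 : 512 * φ ≤ κ ^ 2) :
    ∃ v ∈ A 0, ∃ B : Fin m → Finset V, (∀ j, B j ⊆ A j.succ) ∧
      (∀ j, ∀ y ∈ B j, if s j then G.Adj v y ∧ ¬ R v y else ¬ G.Adj v y) ∧
      (∀ j, μ / 2 * (1 - (θ + κ) / 2) ≤ #(B j)) ∧
      ∑ i, ∑ j, ∑ x ∈ B i, ∑ y ∈ B j, (if R x y then (1 : ℝ) else 0) ≤
        (μ / 2) ^ 2 * φ * (1 + (θ + κ)) := by
  set r : V → V → ℝ := fun x y => if R x y then (1 : ℝ) else 0 with hr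
  have hr0 : ∀ x y, 0 ≤ r x y := fun x y => by simp only [hr]; split_ifs <;> simp
  have hr1 : ∀ x y, |r x y| ≤ 1 := fun x y => by simp only [hr]; split_ifs <;> simp
  have hsumr : ∀ v (Y : Finset V), ∑ y ∈ Y, r v y = #{y ∈ Y | R v y} := fun v Y => by
    simp only [hr, sum_boole]
  have ha : μ / 2 ≤ #(A 0) := le_trans (by nlinarith) (hA 0)
  have ha0 : (0 : ℝ) < #(A 0) := by linarith
  -- vertices with unbalanced neighbourhoods
  set U : Fin m → Finset V := fun j =>
    {v ∈ A 0 | (#{y ∈ A j.succ | (G.Adj v y ↔ s j = true)} : ℝ) ≤ #(A j.succ) / 2 - μ * κ / 8}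
    with hU
  have hUc : ∀ j, (#(U j) : ℝ) ≤ #(A 0) * κ ^ 2 / 16 := by
    intro j
    have := card_deficient_mul_le G hσ hV hG (s j) (μ * κ / 8) (U j) (A j.succ)
      ((hd j).mono_left (filter_subset _ _)) (fun a ha => (mem_filter.1 ha).2)
    have h4 : μ * κ * #(U j) ≤ μ * κ * (μ / 2 * κ ^ 2 / 16) := by linarith
    have h5 := le_of_mul_le_mul_left h4 (by positivity)
    nlinarith [sq_nonneg κ]
  -- vertices of large `R`-degree
  set W : Finset V := {v ∈ A 0 | μ * κ / 8 ≤ ∑ j : Fin m, ∑ y ∈ A j.succ, r v y} with hW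
  have hWc : (#W : ℝ) ≤ #(A 0) * κ / 16 := by
    have h4 : μ * κ / 8 * #W ≤ μ ^ 2 * φ * (1 + θ) := by
      calc μ * κ / 8 * #W = ∑ v ∈ W, μ * κ / 8 := by simp [mul_comm]
        _ ≤ ∑ v ∈ W, ∑ j : Fin m, ∑ y ∈ A j.succ, r v y :=
          sum_le_sum fun v hv => (mem_filter.1 hv).2
        _ ≤ ∑ v ∈ A 0, ∑ j : Fin m, ∑ y ∈ A j.succ, r v y :=
          sum_le_sum_of_subset_of_nonneg (filter_subset _ _) fun v _ _ =>
            sum_nonneg fun _ _ => sum_nonneg fun _ _ => hr0 _ _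
        _ = ∑ j : Fin m, ∑ x ∈ A 0, ∑ y ∈ A j.succ, r x y := sum_comm
        _ ≤ ∑ j, ∑ x ∈ A 0, ∑ y ∈ A j, r x y := by
          rw [Fin.sum_univ_succ]
          exact le_add_of_nonneg_left (sum_nonneg fun _ _ => sum_nonneg fun _ _ => hr0 _ _)
        _ ≤ ∑ i, ∑ j, ∑ x ∈ A i, ∑ y ∈ A j, r x y :=
          single_le_sum (f := fun i => ∑ j, ∑ x ∈ A i, ∑ y ∈ A j, r x y)
            (fun i _ => sum_nonneg fun _ _ => sum_nonneg fun _ _ => sum_nonneg fun _ _ => hr0 _ _)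
            (mem_univ 0)
        _ ≤ _ := hΦ
    have h5 : μ ^ 2 * φ * (1 + θ) ≤ μ * κ / 8 * (μ / 2 * κ / 16) := by
      have : φ * (1 + θ) ≤ κ ^ 2 / 256 := by nlinarith
      calc μ ^ 2 * φ * (1 + θ) = μ ^ 2 * (φ * (1 + θ)) := by ring
        _ ≤ μ ^ 2 * (κ ^ 2 / 256) := by gcongr
        _ = _ := by ring
    have h6 := le_of_mul_le_mul_left (h4.trans h5) (by positivity)
    nlinarith
  set D : Finset V := A 0 \ (univ.biUnion U ∪ W) with hD
  have hDc : #(A 0) * (1 - κ / 8) ≤ (#D : ℝ) := by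
    have h4 : #(A 0) ≤ #D + (∑ j, #(U j) + #W) := by
      calc #(A 0) ≤ #D + #(univ.biUnion U ∪ W) := by
            rw [hD]; exact Nat.le_add_of_sub_le (le_card_sdiff _ _)
        _ ≤ _ := by
          gcongr
          exact (card_union_le _ _).trans (by gcongr; exact card_biUnion_le)
    have h5 : (#(A 0) : ℝ) ≤ #D + (∑ j, (#(U j) : ℝ) + #W) := by exact_mod_cast h4
    have h6 : ∑ j, (#(U j) : ℝ) ≤ #(A 0) * κ / 16 := by
      calc ∑ j, (#(U j) : ℝ) ≤ ∑ _j : Fin m, #(A 0) * κ ^ 2 / 16 := sum_le_sum fun j _ => hUc j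
        _ = (m * κ) * (#(A 0) * κ / 16) := by simp; ring
        _ ≤ 1 * (#(A 0) * κ / 16) := by gcongr
        _ = _ := one_mul _
    linarith
  -- the density of `R` after choosing `v`
  set ε : Fin m → ℝ := fun j => if s j then 1 else -1 with hε
  have hε1 : ∀ j, |ε j| ≤ 1 := fun j => by simp only [hε]; split_ifs <;> simp
  -- For `x ≠ v` this is the indicator of the prescribed adjacency to `v`, written linearly in `sgn`
  -- so that the averaging bound applies. `R`-neighbours of `v` are deleted only later, which can
  -- only decrease the sum.
  set p : Fin m → V → V → ℝ := fun j v x => (1 + ε j * G.sgn v x) / 2 with hp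
  have hp0 : ∀ j v x, 0 ≤ p j v x := by
    intro j v x
    have : |ε j * G.sgn v x| ≤ 1 := by
      rw [abs_mul]; exact mul_le_one₀ (hε1 j) (abs_nonneg _) (G.abs_sgn_le _ _)
    have := (abs_le.1 this).1
    simp only [hp]; linarith
  set Φ : V → ℝ := fun v => ∑ i : Fin m, ∑ j : Fin m, ∑ x ∈ A i.succ, ∑ y ∈ A j.succ,
    r x y * p i v x * p j v y with hΦdef
  have hΦ0 : ∀ v, 0 ≤ Φ v := fun v => sum_nonneg fun _ _ => sum_nonneg fun _ _ =>
    sum_nonneg fun _ _ => sum_nonneg fun _ _ => mul_nonneg (mul_nonneg (hr0 _ _) (hp0 _ _ _))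
      (hp0 _ _ _)
  have hκ1 : κ ≤ 1 := by linarith
  have havg : ∑ v ∈ A 0, Φ v ≤ #(A 0) * (μ ^ 2 * φ / 4 * (1 + θ + κ / 4)) := by
    have hX : ∑ i : Fin m, ∑ j : Fin m, ∑ x ∈ A i.succ, ∑ y ∈ A j.succ, r x y ≤
        μ ^ 2 * φ * (1 + θ) := by
      refine le_trans ?_ hΦ
      rw [Fin.sum_univ_succ]
      refine le_add_of_nonneg_of_le (sum_nonneg fun _ _ => sum_nonneg fun _ _ =>
        sum_nonneg fun _ _ => hr0 _ _) (sum_le_sum fun i _ => ?_)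
      rw [Fin.sum_univ_succ]
      exact le_add_of_nonneg_left (sum_nonneg fun _ _ => sum_nonneg fun _ _ => hr0 _ _)
    have hE : (m : ℝ) ^ 2 * (3 / 4 * σ ^ 5) ≤ #(A 0) * (μ ^ 2 * φ * κ / 16) := by
      have h4 : (m : ℝ) ^ 2 * κ ^ 2 ≤ 1 := by
        rw [← mul_pow]; exact pow_le_one₀ (by positivity) hm
      calc (m : ℝ) ^ 2 * (3 / 4 * σ ^ 5) ≤ (m : ℝ) ^ 2 * (μ ^ 3 * φ * κ ^ 3 / 32) := by
            gcongr; linarith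
        _ = (m : ℝ) ^ 2 * κ ^ 2 * (μ ^ 3 * φ * κ / 32) := by ring
        _ ≤ 1 * (μ ^ 3 * φ * κ / 32) := by gcongr
        _ = μ / 2 * (μ ^ 2 * φ * κ / 16) := by ring
        _ ≤ _ := by gcongr
    calc ∑ v ∈ A 0, Φ v = ∑ i : Fin m, ∑ j : Fin m, ∑ v ∈ A 0, ∑ x ∈ A i.succ, ∑ y ∈ A j.succ,
          r x y * p i v x * p j v y := by
          simp only [hΦdef]
          rw [sum_comm]
          exact sum_congr rfl fun i _ => sum_comm
      _ ≤ ∑ i : Fin m, ∑ j : Fin m, (#(A 0) / 4 * (∑ x ∈ A i.succ, ∑ y ∈ A j.succ, r x y) +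
          3 / 4 * σ ^ 5) := sum_le_sum fun i _ => sum_le_sum fun j _ =>
            hG.sum_weight_le hσ hV G.abs_sgn_le _ _ _ r hr1 (ε i) (ε j) (hε1 i) (hε1 j)
      _ = #(A 0) / 4 * (∑ i : Fin m, ∑ j : Fin m, ∑ x ∈ A i.succ, ∑ y ∈ A j.succ, r x y) +
          (m : ℝ) ^ 2 * (3 / 4 * σ ^ 5) := by
          simp only [sum_add_distrib, ← mul_sum, sum_const, card_univ, Fintype.card_fin,
            nsmul_eq_mul]
          ring
      _ ≤ #(A 0) / 4 * (μ ^ 2 * φ * (1 + θ)) + #(A 0) * (μ ^ 2 * φ * κ / 16) := by gcongr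
      _ = _ := by ring
  obtain ⟨v, hvD, hv⟩ : ∃ v ∈ D, Φ v ≤ (μ / 2) ^ 2 * φ * (1 + (θ + κ)) := by
    by_contra hall
    push Not at hall
    have h4 : #D * ((μ / 2) ^ 2 * φ * (1 + (θ + κ))) ≤ ∑ v ∈ A 0, Φ v := by
      calc #D * ((μ / 2) ^ 2 * φ * (1 + (θ + κ))) = ∑ v ∈ D, (μ / 2) ^ 2 * φ * (1 + (θ + κ)) := by
            simp
        _ ≤ ∑ v ∈ D, Φ v := sum_le_sum fun v hv => (hall v hv).le
        _ ≤ _ := sum_le_sum_of_subset_of_nonneg sdiff_subset fun v _ _ => hΦ0 v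
    have h5 : #(A 0) * (1 - κ / 8) * ((μ / 2) ^ 2 * φ * (1 + (θ + κ))) ≤
        #(A 0) * (μ ^ 2 * φ / 4 * (1 + θ + κ / 4)) :=
      le_trans (mul_le_mul_of_nonneg_right hDc (by positivity)) (h4.trans havg)
    have h6 : #(A 0) * (μ ^ 2 * φ / 4) * ((1 - κ / 8) * (1 + (θ + κ))) ≤
        #(A 0) * (μ ^ 2 * φ / 4) * (1 + θ + κ / 4) := by linarith
    have h7 := le_of_mul_le_mul_left h6 (by positivity)
    -- Since `θ + κ ≤ 1`, the left factor is at least `1 + θ + 3κ/4`, which exceeds `1 + θ + κ/4`.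
    nlinarith
  have hvA : v ∈ A 0 := (mem_sdiff.1 hvD).1
  have hvU : ∀ j, v ∉ U j := fun j hj => (mem_sdiff.1 hvD).2
    (mem_union_left _ (mem_biUnion.2 ⟨j, mem_univ _, hj⟩))
  have hvW : v ∉ W := fun hj => (mem_sdiff.1 hvD).2 (mem_union_right _ hj)
  refine ⟨v, hvA, fun j => {y ∈ A j.succ | (G.Adj v y ↔ s j = true)} \ {y ∈ A j.succ | R v y},
    fun j => sdiff_subset.trans (filter_subset _ _), fun j y hy => ?_, fun j => ?_, ?_⟩
  · obtain ⟨hy1, hy2⟩ := mem_sdiff.1 hy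
    obtain ⟨hyA, hy3⟩ := mem_filter.1 hy1
    split_ifs with hs
    · exact ⟨hy3.2 hs, fun h => hy2 (mem_filter.2 ⟨hyA, h⟩)⟩
    · exact fun h => hs (hy3.1 h)
  · have h4 : #(A j.succ) / 2 - μ * κ / 8 ≤
        (#{y ∈ A j.succ | (G.Adj v y ↔ s j = true)} : ℝ) := by
      by_contra hlt
      exact hvU j (mem_filter.2 ⟨hvA, (not_le.1 hlt).le⟩)
    have h5 : (#{y ∈ A j.succ | R v y} : ℝ) ≤ μ * κ / 8 := by
      by_contra hlt
      refine hvW (mem_filter.2 ⟨hvA, (not_le.1 hlt).le.trans ?_⟩)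
      rw [← hsumr]
      exact single_le_sum (f := fun j : Fin m => ∑ y ∈ A j.succ, r v y)
        (fun _ _ => sum_nonneg fun _ _ => hr0 _ _) (mem_univ j)
    have h6 : (#{y ∈ A j.succ | (G.Adj v y ↔ s j = true)} : ℝ) ≤
        #({y ∈ A j.succ | (G.Adj v y ↔ s j = true)} \ {y ∈ A j.succ | R v y}) +
        #{y ∈ A j.succ | R v y} := by
      exact_mod_cast Nat.le_add_of_sub_le (le_card_sdiff _ _)
    have h7 := hA j.succ
    -- Imbalance and deletion each cost `μκ/8`, together exactly the allowed `(μ/2)(κ/2)`.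
    nlinarith
  · refine le_trans (sum_le_sum fun i _ => sum_le_sum fun j _ => ?_) hv
    have hpone : ∀ j : Fin m, ∀ y ∈ {y ∈ A j.succ | (G.Adj v y ↔ s j = true)} \
        {y ∈ A j.succ | R v y}, p j v y = 1 := by
      intro j y hy
      obtain ⟨hyA, hy3⟩ := mem_filter.1 (mem_sdiff.1 hy).1
      have hne : v ≠ y := fun h => disjoint_left.1 (hd j) hvA (h ▸ hyA)
      cases hs : s j
      · have h4 : ¬ G.Adj v y := fun h => by simpa [hs] using hy3.1 h
        simp only [hp, hε, hs, SimpleGraph.sgn_of_not_adj hne h4]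
        norm_num
      · simp only [hp, hε, hs, SimpleGraph.sgn_of_adj (hy3.2 hs)]
        norm_num
    have hsub : ∀ j : Fin m, {y ∈ A j.succ | (G.Adj v y ↔ s j = true)} \
        {y ∈ A j.succ | R v y} ⊆ A j.succ := fun j => sdiff_subset.trans (filter_subset _ _)
    refine le_trans (sum_le_sum fun x hx => ?_) (sum_le_sum_of_subset_of_nonneg (hsub i)
      fun x _ _ => sum_nonneg fun y _ => mul_nonneg (mul_nonneg (hr0 _ _) (hp0 _ _ _))
        (hp0 _ _ _))
    refine le_trans (sum_le_sum fun y hy => ?_) (sum_le_sum_of_subset_of_nonneg (hsub j)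
      fun y _ _ => mul_nonneg (mul_nonneg (hr0 _ _) (hp0 _ _ _)) (hp0 _ _ _))
    rw [hpone i x hx, hpone j y hy, mul_one, mul_one]

open Classical in
/-- If `R` is sparse on the union of the disjoint large sets `A i`, every pattern is realised by
edges outside `R` and non-edges of the pseudo-random graph `G`. -/
theorem exists_pattern_avoiding {V : Type*} [Fintype V] (G : SimpleGraph V) {σ : ℝ} (hσ : 0 ≤ σ)
    (hV : (Fintype.card V : ℝ) = σ ^ 2) (hG : BilinBound G.sgn (σ ^ 2)) (R : V → V → Prop)
    (k : ℕ) (hk : 0 < k) (s : Fin k → Fin k → Bool) (A : Fin k → Finset V)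
    (hd : ∀ i j, i ≠ j → Disjoint (A i) (A j)) (N φ : ℝ) (hN : 0 < N) (hφ : 0 < φ)
    (hA : ∀ j, N ≤ #(A j))
    (hΦ : ∑ i, ∑ j, ∑ x ∈ A i, ∑ y ∈ A j, (if R x y then (1 : ℝ) else 0) ≤ N ^ 2 * φ)
    (h1 : 128 * σ ^ 3 * k ^ 3 * 4 ^ k ≤ N ^ 2) (h2 : 24 * σ ^ 5 * k ^ 3 * 8 ^ k ≤ N ^ 3 * φ)
    (h3 : 512 * φ * k ^ 2 ≤ 1) :
    ∃ f : Fin k → V, (∀ j, f j ∈ A j) ∧ ∀ i j, i < j →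
      if s i j then G.Adj (f i) (f j) ∧ ¬ R (f i) (f j) else ¬ G.Adj (f i) (f j) := by
  have hk0 : (0 : ℝ) < k := by exact_mod_cast hk
  refine exists_pattern_of_step (fun b v y => if b then G.Adj v y ∧ ¬ R v y else ¬ G.Adj v y)
    (fun m A => m ≤ k ∧ (∀ i j, i ≠ j → Disjoint (A i) (A j)) ∧
      (∀ j, N * 2 ^ m / 2 ^ k * (1 - (1 - m / k : ℝ) / 2) ≤ #(A j)) ∧
      ∑ i, ∑ j, ∑ x ∈ A i, ∑ y ∈ A j, (if R x y then (1 : ℝ) else 0) ≤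
        (N * 2 ^ m / 2 ^ k) ^ 2 * φ * (1 + (1 - m / k : ℝ))) ?_ k s A
      ⟨le_rfl, hd, fun j => ?_, ?_⟩
  · rintro m A s ⟨hmk, hAd, hAc, hAΦ⟩
    have hmk' : (m + 1 : ℝ) ≤ k := by exact_mod_cast hmk
    -- The step is applied with scale `μ` halving each time, `κ = 1 / k`, and accumulated error `θ`
    -- rising from 0 to 1. The conditions on `σ` are checked at the lower bound `N / 2 ^ k` for the
    -- scale, whence `4 ^ k` and `8 ^ k`.
    have hle : N / 2 ^ k ≤ N * 2 ^ (m + 1) / 2 ^ k := by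
      gcongr
      exact le_mul_of_one_le_right hN.le (one_le_pow₀ (by norm_num))
    obtain ⟨v, hv, B, hBA, hBr, hBc, hBΦ⟩ := exists_step_vertex G hσ hV hG R m s A
      (fun j => hAd _ _ (Fin.succ_ne_zero j).symm) (1 / k) (N * 2 ^ (m + 1) / 2 ^ k) φ
      (1 - (m + 1 : ℕ) / k) (by positivity) (by rw [mul_one_div, div_le_one hk0]; linarith)
      (by positivity) hφ (by rw [sub_nonneg, div_le_one hk0]; exact_mod_cast hmk)
      (by push_cast; rw [add_div]; have : 0 ≤ (m / k : ℝ) := by positivity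
          linarith) hAc hAΦ
      (by
        refine le_trans ?_ (mul_le_mul_of_nonneg_right (pow_le_pow_left₀ (by positivity) hle 2)
          (by positivity))
        have e : (N / 2 ^ k) ^ 2 * (1 / (k : ℝ)) ^ 3 = N ^ 2 / (k ^ 3 * 4 ^ k) := by
          rw [div_pow, div_pow, ← pow_mul, mul_comm k 2, pow_mul]; norm_num
          field_simp
        rw [e, le_div_iff₀ (by positivity)]
        linarith)
      (by
        refine le_trans ?_ (mul_le_mul_of_nonneg_right (mul_le_mul_of_nonneg_right
          (pow_le_pow_left₀ (by positivity) hle 3) hφ.le) (by positivity))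
        have e : (N / 2 ^ k) ^ 3 * φ * (1 / (k : ℝ)) ^ 3 = N ^ 3 * φ / (k ^ 3 * 8 ^ k) := by
          rw [div_pow, div_pow, ← pow_mul, mul_comm k 3, pow_mul]; norm_num
          field_simp
        rw [e, le_div_iff₀ (by positivity)]
        linarith)
      (by rw [div_pow, le_div_iff₀ (by positivity)]; linarith)
    have e1 : N * 2 ^ (m + 1) / 2 ^ k / 2 = N * 2 ^ m / 2 ^ k := by rw [pow_succ]; ring
    have e2 : 1 - ((m + 1 : ℕ) : ℝ) / k + 1 / k = 1 - m / k := by push_cast; ring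
    rw [e1, e2] at hBΦ
    simp only [e1, e2] at hBc
    refine ⟨v, hv, B, ⟨by omega, fun i j hij => ?_, hBc, hBΦ⟩, hBA, hBr⟩
    exact ((hAd _ _ (by simpa using hij)).mono_left (hBA i)).mono_right (hBA j)
  · rw [div_self hk0.ne', mul_div_assoc, div_self (by positivity)]
    simpa using hA j
  · rw [div_self hk0.ne', mul_div_assoc, div_self (by positivity)]
    simpa using hΦ

/-! ### Assembling the two embeddings -/

theorem hasInducedMonoCopy_of_pattern {V : Type*} {G : SimpleGraph V} {k : ℕ}
    (H : SimpleGraph (Fin k)) (C : G.EdgeLabeling (Fin 2)) (a : Fin 2) (f : Fin k → V)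
    (hf : Function.Injective f) (s : Fin k → Fin k → Bool) (hs : ∀ i j, s i j = true ↔ H.Adj i j)
    (h : ∀ i j, i < j → if s i j then (∃ h : G.Adj (f i) (f j), C.get (f i) (f j) h = a)
      else ¬ G.Adj (f i) (f j)) : HasInducedMonoCopy H C := by
  have h1 : ∀ i j, i < j → (G.Adj (f i) (f j) ↔ H.Adj i j) := by
    intro i j hij
    have := h i j hij
    split_ifs at this with hb
    · exact iff_of_true this.1 ((hs i j).1 hb)
    · exact iff_of_false this (fun h' => hb ((hs i j).2 h'))
  refine ⟨⟨⟨f, hf⟩, ?_⟩, a, ?_⟩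
  · intro i j
    show G.Adj (f i) (f j) ↔ H.Adj i j
    rcases lt_trichotomy i j with hij | hij | hij
    · exact h1 i j hij
    · subst hij; simp
    · rw [G.adj_comm, H.adj_comm]; exact h1 j i hij
  · intro u v huv
    show C.get (f u) (f v) _ = a
    rcases lt_trichotomy u v with hij | hij | hij
    · have := h u v hij
      rw [if_pos ((hs u v).2 huv)] at this
      exact this.2
    · exact absurd hij huv.ne
    · have := h v u hij
      rw [if_pos ((hs v u).2 huv.symm)] at this
      rw [C.get_comm]
      exact this.2

open Classical in
theorem sum_blocks_le {V : Type*} (R : V → V → Prop) {k : ℕ} (T : Finset V)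
    (A : Fin k → Finset V) (hA : ∀ i, A i ⊆ T) (hd : ∀ i j, i ≠ j → Disjoint (A i) (A j)) :
    ∑ i, ∑ j, ∑ x ∈ A i, ∑ y ∈ A j, (if R x y then (1 : ℝ) else 0) ≤
      ((∑ x ∈ T, #{y ∈ T | R x y} : ℕ) : ℝ) := by
  have h1 : ∀ g : V → ℝ, (∀ x, 0 ≤ g x) → ∑ i, ∑ x ∈ A i, g x ≤ ∑ x ∈ T, g x := by
    intro g hg
    rw [← sum_biUnion (fun i _ j _ hij => hd i j hij)]
    exact sum_le_sum_of_subset_of_nonneg (biUnion_subset.2 fun i _ => hA i) fun x _ _ => hg x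
  have h0 : ∀ x y, (0 : ℝ) ≤ if R x y then (1 : ℝ) else 0 := fun x y => by split_ifs <;> simp
  push_cast
  simp only [← sum_boole]
  calc _ = ∑ i, ∑ x ∈ A i, ∑ j, ∑ y ∈ A j, (if R x y then (1 : ℝ) else 0) :=
        sum_congr rfl fun i _ => sum_comm
    _ ≤ ∑ i, ∑ x ∈ A i, ∑ y ∈ T, (if R x y then (1 : ℝ) else 0) :=
        sum_le_sum fun i _ => sum_le_sum fun x _ => h1 _ (h0 x)
    _ ≤ _ := h1 _ fun x => sum_nonneg fun y _ => h0 x y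

/-- A pseudo-random graph on sufficiently many vertices is an induced Ramsey graph. -/
theorem hasInducedMonoCopy_of_bilinBound {V : Type*} [Fintype V] (G : SimpleGraph V) {n : ℕ}
    (hV : Fintype.card V = n) (hG : BilinBound G.sgn n) (k l : ℕ) (hk : 0 < k) (hl : 0 < l)
    (hkl : k ≤ 2 ^ l) (hn : 2 ^ (1722 * (k * l ^ 2)) ≤ n) (H : SimpleGraph (Fin k))
    (C : G.EdgeLabeling (Fin 2)) : HasInducedMonoCopy H C := by
  classical
  by_contra hno
  -- `D` is the loss in one sparse-pair step with `h = 15 * l`, and `Q` the loss after `15 * l`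
  -- rounds. The later conditions need `√n ≥ 8 ^ (k + 1) * Q ^ 3`, and `1722 = 6 * 285 + 12`.
  set D := 2 * k ^ 2 * 2 ^ (15 * l * k) with hD
  have hD0 : 0 < D := by positivity
  set Q := (2 * D) ^ (15 * l) with hQ
  have hQ0 : 0 < Q := by positivity
  have hkl1 : 1 ≤ k * l := Nat.mul_pos hk hl
  have hkl2 : 1 ≤ k * l ^ 2 := Nat.mul_pos hk (by positivity)
  have hQle : Q ≤ 2 ^ (285 * (k * l ^ 2)) := by
    have h1 : 2 * D ≤ 2 ^ (19 * (k * l)) := by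
      calc 2 * D = 2 ^ 2 * k ^ 2 * 2 ^ (15 * l * k) := by rw [hD]; ring
        _ ≤ 2 ^ 2 * (2 ^ l) ^ 2 * 2 ^ (15 * l * k) := by gcongr
        _ = 2 ^ (2 + 2 * l + 15 * l * k) := by ring
        _ ≤ _ := by
          apply Nat.pow_le_pow_right (by norm_num)
          nlinarith
    calc Q ≤ (2 ^ (19 * (k * l))) ^ (15 * l) := Nat.pow_le_pow_left h1 _
      _ = _ := by rw [← pow_mul]; ring_nf
  have hnQ : 64 ^ (k + 1) * Q ^ 6 ≤ n := by
    refine le_trans ?_ hn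
    calc 64 ^ (k + 1) * Q ^ 6 ≤ 64 ^ (k + 1) * (2 ^ (285 * (k * l ^ 2))) ^ 6 := by gcongr
      _ = 2 ^ (6 * (k + 1) + 285 * (k * l ^ 2) * 6) := by
        rw [pow_add 2, pow_mul 2 6 (k + 1), pow_mul 2 _ 6, show 2 ^ 6 = 64 by norm_num]
      _ ≤ _ := by
        apply Nat.pow_le_pow_right (by norm_num)
        have : k ≤ k * l ^ 2 := Nat.le_mul_of_pos_right _ (by positivity)
        omega
  set m := n / Q with hm
  set σ : ℝ := Real.sqrt n with hσ
  have hσ0 : 0 ≤ σ := Real.sqrt_nonneg _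
  have hσn : σ ^ 2 = n := Real.sq_sqrt (Nat.cast_nonneg _)
  have hσQ : 8 ^ (k + 1) * (Q : ℝ) ^ 3 ≤ σ := by
    apply Real.le_sqrt_of_sq_le
    calc (8 ^ (k + 1) * (Q : ℝ) ^ 3) ^ (2 : ℕ) = 64 ^ (k + 1) * (Q : ℝ) ^ 6 := by
          rw [mul_pow, ← pow_mul, mul_comm (k + 1), pow_mul]; norm_num; ring
      _ ≤ (n : ℝ) := by exact_mod_cast hnQ
  have hQ1 : (1 : ℝ) ≤ Q := by exact_mod_cast hQ0
  have hσpos : 0 < σ := lt_of_lt_of_le (by positivity) hσQ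
  have hmσ : σ ^ 2 ≤ 2 * Q * m := by
    have hQn : Q ≤ n := by
      refine le_trans ?_ hnQ
      calc Q ≤ Q ^ 6 := Nat.le_self_pow (by norm_num) Q
        _ ≤ _ := Nat.le_mul_of_pos_left _ (by positivity)
    have h1 : 0 < m := Nat.div_pos hQn hQ0
    have h2 := Nat.lt_mul_div_succ n hQ0
    rw [← hm] at h2
    have h3 : n ≤ 2 * Q * m := by nlinarith
    rw [hσn]; exact_mod_cast h3
  have hm0 : (0 : ℝ) < m := by
    by_contra h
    have : 2 * Q * (m : ℝ) ≤ 0 := mul_nonpos_of_nonneg_of_nonpos (by positivity) (not_lt.1 h)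
    nlinarith
  have hm0' : 0 < m := by exact_mod_cast hm0
  have hm3 : σ ^ 5 * 8 ^ k ≤ (m : ℝ) ^ 3 := by
    have h1 : σ ^ 5 * (8 ^ (k + 1) * (Q : ℝ) ^ 3) ≤ 8 * (Q : ℝ) ^ 3 * m ^ 3 := by
      calc σ ^ 5 * (8 ^ (k + 1) * (Q : ℝ) ^ 3) ≤ σ ^ 5 * σ := by gcongr
        _ = (σ ^ 2) ^ 3 := by ring
        _ ≤ (2 * Q * m) ^ 3 := by gcongr
        _ = _ := by ring
    have h2 : 8 * (Q : ℝ) ^ 3 * (σ ^ 5 * 8 ^ k) ≤ 8 * (Q : ℝ) ^ 3 * m ^ 3 := by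
      refine le_trans (le_of_eq ?_) h1
      ring
    exact le_of_mul_le_mul_left h2 (by positivity)
  have hm2 : 2 * (σ ^ 3 * 4 ^ k) ≤ (m : ℝ) ^ 2 := by
    have h0 : 8 * 4 ^ k * (Q : ℝ) ^ 2 ≤ σ := by
      refine le_trans ?_ hσQ
      calc 8 * 4 ^ k * (Q : ℝ) ^ 2 ≤ 8 * 8 ^ k * (Q : ℝ) ^ 3 := by
            gcongr
            · norm_num
            · norm_num
        _ = _ := by ring
    have h1 : σ ^ 3 * (8 * 4 ^ k * (Q : ℝ) ^ 2) ≤ 4 * (Q : ℝ) ^ 2 * m ^ 2 := by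
      calc σ ^ 3 * (8 * 4 ^ k * (Q : ℝ) ^ 2) ≤ σ ^ 3 * σ := by gcongr
        _ = (σ ^ 2) ^ 2 := by ring
        _ ≤ (2 * Q * m) ^ 2 := by gcongr
        _ = _ := by ring
    have h2 : 4 * (Q : ℝ) ^ 2 * (2 * (σ ^ 3 * 4 ^ k)) ≤ 4 * (Q : ℝ) ^ 2 * m ^ 2 := by
      refine le_trans (le_of_eq ?_) h1
      ring
    exact le_of_mul_le_mul_left h2 (by positivity)
  have hσ1 : 1 ≤ σ := le_trans (by
    have : (1 : ℝ) ≤ 8 ^ (k + 1) := one_le_pow₀ (by norm_num)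
    have : (1 : ℝ) ≤ (Q : ℝ) ^ 3 := one_le_pow₀ hQ1
    nlinarith) hσQ
  have hnm : (n : ℝ) < (m : ℝ) ^ 2 := by
    have h4 : (1 : ℝ) ≤ 4 ^ k := one_le_pow₀ (by norm_num)
    have h5 : σ ^ 2 ≤ σ ^ 3 * 4 ^ k := by
      calc σ ^ 2 = σ ^ 2 * 1 * 1 := by ring
        _ ≤ σ ^ 2 * σ * 4 ^ k := by gcongr
        _ = _ := by ring
    rw [← hσn]
    nlinarith
  obtain ⟨R, hR⟩ : ∃ R : V → V → Prop, ∀ x y, R x y ↔ ∃ h : G.Adj x y, C.get x y h = 0 :=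
    ⟨_, fun _ _ => Iff.rfl⟩
  have hRsymm : ∀ x y, R x y → R y x := by
    intro x y hxy
    obtain ⟨h, hc⟩ := (hR x y).1 hxy
    exact (hR y x).2 ⟨h.symm, by rw [C.get_comm]; exact hc⟩
  set s : Fin k → Fin k → Bool := fun i j => decide (H.Adj i j) with hs
  obtain ⟨T, -, hTc, hTe⟩ := exists_sparse_subset R hRsymm (15 * l) D m hD0 (fun S hS => by
    refine exists_sparse_pair G (Nat.cast_nonneg n) hG R k (15 * l) hk (by omega) s ?_ S ?_ ?_
    · intro f hf hpat
      exact hno (hasInducedMonoCopy_of_pattern H C 0 f hf s (by simp [hs])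
        fun i j hij => by simpa only [hR] using hpat i j hij)
    · refine le_trans ?_ hS
      have : k ≤ D := by
        calc k ≤ k ^ 2 := Nat.le_self_pow (by norm_num) k
          _ ≤ k ^ 2 * (2 * 2 ^ (15 * l * k)) := Nat.le_mul_of_pos_right _ (by positivity)
          _ = D := by rw [hD]; ring
      nlinarith
    · have h1 : (2 * D * m : ℝ) ≤ #S := by exact_mod_cast hS
      have h2 : (2 * k ^ 2 * 2 ^ (15 * l * k) : ℝ) = D := by rw [hD]; push_cast; ring
      rw [h2]
      have hD1 : (0 : ℝ) < D := by exact_mod_cast hD0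
      calc 4 * (n : ℝ) * (D : ℝ) ^ 2 < 4 * (m : ℝ) ^ 2 * (D : ℝ) ^ 2 := by gcongr
        _ = (2 * (D : ℝ) * m) ^ 2 := by ring
        _ ≤ _ := by gcongr) (15 * l) univ (by
      rw [card_univ, hV]; exact Nat.mul_div_le n Q)
  -- `T` has `2 ^ l * N` elements, enough for `k` blocks of size `N`. Its `R`-count is at most `3 *
  -- 2 ^ (-15 * l) * #T ^ 2 = N ^ 2 * (3 / L ^ 13)`. The exponent 15 leaves room for `512 * 3 * k ^
  -- 2 ≤ L ^ 13`, already when `L = 2`.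
  set N := 2 ^ (14 * l) * m with hN
  obtain ⟨A, hAT, hAc, hAd⟩ := exists_disjoint_subsets N k T (by
    rw [hTc]
    calc k * N ≤ 2 ^ l * N := by gcongr
      _ = _ := by rw [hN, show 15 * l = l + 14 * l by ring, pow_add]; ring)
  set L : ℝ := 2 ^ l with hL
  have hL2 : 2 ≤ L := by
    calc (2 : ℝ) = 2 ^ 1 := by norm_num
      _ ≤ 2 ^ l := pow_le_pow_right₀ (by norm_num) hl
  have hkL : (k : ℝ) ≤ L := by rw [hL]; exact_mod_cast hkl
  have hLpow : ∀ a, (2 : ℝ) ^ (a * l) = L ^ a := fun a => by rw [hL, ← pow_mul, mul_comm]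
  have hNL : (N : ℝ) = L ^ 14 * m := by rw [hN]; push_cast; rw [hLpow]
  have hL11 : (2048 : ℝ) ≤ L ^ 11 := by
    calc (2048 : ℝ) = 2 ^ 11 := by norm_num
      _ ≤ _ := by gcongr
  obtain ⟨f, hfA, hf⟩ := exists_pattern_avoiding G hσ0 (by rw [hσn, hV]) (by rwa [hσn]) R k hk s A
    hAd N (3 / L ^ 13) (by rw [hNL]; positivity) (by positivity) (fun j => by rw [hAc]) (by
      refine (sum_blocks_le R T A hAT hAd).trans ?_
      have h1 : ((2 ^ (15 * l) * (∑ x ∈ T, #{y ∈ T | R x y}) : ℕ) : ℝ) ≤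
          (((2 ^ (15 * l) * 2 ^ (15 * l) + 2 * 4 ^ (15 * l)) * m ^ 2 : ℕ) : ℝ) := by
        exact_mod_cast hTe
      rw [show 4 = 2 * 2 by norm_num, mul_pow] at h1
      rw [Nat.cast_mul] at h1
      generalize ((∑ x ∈ T, #{y ∈ T | R x y} : ℕ) : ℝ) = E at h1 ⊢
      push_cast at h1
      rw [hLpow] at h1
      rw [hNL]
      have h2 : L ^ 15 * E ≤ L ^ 15 * ((L ^ 14 * m) ^ 2 * (3 / L ^ 13)) := by
        refine h1.trans (le_of_eq ?_)
        field_simp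
        ring
      exact le_of_mul_le_mul_left h2 (by positivity)) (by
      rw [hNL]
      calc 128 * σ ^ 3 * k ^ 3 * 4 ^ k = 64 * (k : ℝ) ^ 3 * (2 * (σ ^ 3 * 4 ^ k)) := by ring
        _ ≤ L ^ 11 * L ^ 3 * (m : ℝ) ^ 2 := by
          gcongr
          linarith
        _ ≤ L ^ 11 * L ^ 3 * (m : ℝ) ^ 2 * L ^ 14 :=
          le_mul_of_one_le_right (by positivity) (one_le_pow₀ (by linarith))
        _ = _ := by ring) (by
      rw [hNL]
      calc 24 * σ ^ 5 * k ^ 3 * 8 ^ k = 24 * (k : ℝ) ^ 3 * (σ ^ 5 * 8 ^ k) := by ring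
        _ ≤ L ^ 11 * L ^ 3 * (m : ℝ) ^ 3 := by
          gcongr
          linarith
        _ ≤ L ^ 11 * L ^ 3 * (m : ℝ) ^ 3 * (3 * L ^ 15) :=
          le_mul_of_one_le_right (by positivity) (by
            have : (1 : ℝ) ≤ L ^ 15 := one_le_pow₀ (by linarith)
            linarith)
        _ = _ := by field_simp) (by
      rw [← mul_div_assoc, div_mul_eq_mul_div, div_le_one (by positivity)]
      calc 512 * 3 * (k : ℝ) ^ 2 ≤ L ^ 11 * L ^ 2 := by
            gcongr
            linarith
        _ = _ := by ring)
  refine hno (hasInducedMonoCopy_of_pattern H C 1 f (fun i j hij => ?_) s (by simp [hs]) ?_)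
  · by_contra hne
    exact disjoint_left.1 (hAd i j hne) (hfA i) (hij ▸ hfA j)
  · intro i j hij
    have := hf i j hij
    split_ifs at this ⊢
    · refine ⟨this.1, ?_⟩
      have h0 : C.get (f i) (f j) this.1 ≠ 0 := fun h => this.2 ((hR _ _).2 ⟨this.1, h⟩)
      omega
    · exact this

theorem corollary1p6 :
    ∃ c : ℝ, 0 < c ∧
      ∀ (k n : ℕ) [Fact n.Prime] (hn4 : n % 4 = 1),
        (2 : ℝ) ^ (c * (k : ℝ) * (Real.logb 2 (k : ℝ)) ^ 2) ≤ (n : ℝ) →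
        ∀ (H : SimpleGraph (Fin k))
          (C : (paleyGraph (ZMod n) (Nat.card_zmod n) hn4).EdgeLabeling (Fin 2)),
          HasInducedMonoCopy H C := by
  -- `6888 = 4 * 1722`: rounding the logarithm up at most doubles it when `k ≥ 2`, and it enters
  -- squared.
  refine ⟨6888, by norm_num, fun k n _ hn4 hn H C => ?_⟩
  rcases Nat.lt_or_ge k 2 with hk | hk
  · have hsub : Subsingleton (Fin k) := Fin.subsingleton_iff_le_one.2 (by omega)
    refine ⟨⟨⟨fun _ => 0, fun i j _ => Subsingleton.elim i j⟩, fun {i j} => ?_⟩, 0, fun u v h => ?_⟩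
    · rw [Subsingleton.elim i j]
      simp
    · exact absurd (Subsingleton.elim u v) h.ne
  · have hk0 : (0 : ℝ) < k := by positivity
    have hlog1 : 1 ≤ Real.logb 2 k := by
      rw [Real.le_logb_iff_rpow_le (by norm_num) hk0]
      simpa using (by exact_mod_cast hk : (2 : ℝ) ≤ k)
    have hl : 0 < Nat.clog 2 k := Nat.clog_pos (by norm_num) hk
    have hlog : (Nat.clog 2 k : ℝ) ≤ 2 * Real.logb 2 k := by
      have h1 : 2 ^ (Nat.clog 2 k - 1) < k := Nat.pow_pred_clog_lt_self (by norm_num) hk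
      have h2 : ((Nat.clog 2 k - 1 : ℕ) : ℝ) ≤ Real.logb 2 k := by
        rw [Real.le_logb_iff_rpow_le (by norm_num) hk0, Real.rpow_natCast]
        exact_mod_cast h1.le
      rw [Nat.cast_sub hl] at h2
      push_cast at h2
      linarith
    refine hasInducedMonoCopy_of_bilinBound _ (ZMod.card n) (bilinBound_paleyGraph _ hn4) k
      (Nat.clog 2 k) (by omega) hl (Nat.le_pow_clog (by norm_num) k) ?_ H C
    have h3 : (2 : ℝ) ^ (1722 * (k * Nat.clog 2 k ^ 2)) ≤ n := by
      refine le_trans ?_ hn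
      rw [← Real.rpow_natCast]
      apply Real.rpow_le_rpow_of_exponent_le (by norm_num)
      push_cast
      calc (1722 * (k * (Nat.clog 2 k : ℝ) ^ 2)) ≤ 1722 * (k * (2 * Real.logb 2 k) ^ 2) := by
            gcongr
        _ = _ := by ring
    exact_mod_cast h3
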